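/- \textbf{Setting.} A (finite-horizon) Dec-POMDP $D$ consists of agents $\mathcal N=\{1,\dots,N\}$, a finite state set $\mathcal S$, finite action and observation sets $\mathcal A_i,\mathcal O_i$ for $i\in\mathcal N$ (with $\mathcal A=\prod_i\mathcal A_i$, $\mathcal O=\prod_i\mathcal O_i$), kernels $P:\mathcal S\times\mathcal A\to\Delta(\mathcal S)$ and $O:\mathcal S\times\mathcal A\to\Delta(\mathcal O)$, a reward $\mathcal R:\mathcal S\times\mathcal A\to\mathbb R$, an initial distribution $b_0\in\Delta(\mathcal S)$ and a horizon $T\in\mathbb N_0$. A local policy $\pi_i\in\Pi_i$ assigns to every history $\tau_{i,t}\in(\mathcal A_i\times\mathcal O_i)^t$, $0\le t\le T$, an element of $\Delta(\mathcal A_i)$; $\Pi^D=\prod_i\Pi_i$ carries its Borel $\sigma$-algebra, and $\Delta(\Pi^D)$ is the set of probability measures on it. Under $\mathbb P_\pi$, $S_0\sim b_0$, $A_{i,t}\sim\pi_i(\cdot\mid\overline{AO}_{i,t})$ independently over $i$, where $\overline{AO}_{i,t}=(A_{i,0},O_{i,1},\dots,A_{i,t-1},O_{i,t})$, $S_{t+1}\sim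 P(\cdot\mid S_t,A_t)$ and $O_{t+1}\sim O(\cdot\mid S_{t+1},A_t)$; and $J^D(\pi)=\mathbb E_\pi[\sum_{t=0}^T\mathcal R(S_t,A_t)]$. An isomorphism $f\in\mathrm{Iso}(D,E)$ between Dec-POMDPs of equal horizon is a tuple of bijections $f_N:\mathcal N^D\to\mathcal N^E$, $f_S:\mathcal S^D\to\mathcal S^E$, $f_{A_i}:\mathcal A_i^D\to\mathcal A^E_{f_N(i)}$, $f_{O_i}:\mathcal O_i^D\to\mathcal O^E_{f_N(i)}$ which preserves $P$, $O$, $\mathcal R$ and $b_0$; $\mathrm{Aut}(D)=\mathrm{Iso}(D,D)$. The pushforward $f^*\pi\in\Pi^E$ of $\pi\in\Pi^D$ is $(f^*\pi)_j(a\mid\tau)=\pi_{f^{-1}j}(f^{-1}a\mid f^{-1}\tau)$, and $f^*\nu$ is the image of $\nu\in\Delta(\Pi^D)$ under $\pi\mapsto f^*\pi$. A labeling $f\in\mathrm{Sym}(D)$ is a tuple of bijections $\mathcal N\to\{1,\dots,N\}$, $\mathcal S\to\{1,\dots,|\mathcal S|\}$, $\mathcal A_i\to\{1,\dots,|\mathcal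 A_i|\}$, $\mathcal O_i\to\{1,\dots,|\mathcal O_i|\}$; $f^*D$ is the Dec-POMDP obtained from $D$ by renaming everything along $f$; and $\mathcal D=\{f^*D\mid f\in\mathrm{Sym}(D)\}$, a finite set. A learning algorithm $\sigma\in\Sigma^{\mathcal D}$ assigns to each $E\in\mathcal D$ some $\sigma(E)\in\Delta(\Pi^E)$. With $\mathcal U$ denoting uniform distributions and all draws independent, the payoff of the label-free coordination (LFC) game for $D$ is \[U^D(\boldsymbol\sigma)=\mathbb E_{D_i\sim\mathcal U(\mathcal D),\,i\in\mathcal N}\Big[\mathbb E_{f_j\sim\mathcal U(\mathrm{Iso}(D_j,D)),\,j\in\mathcal N}\Big[\mathbb E_{\pi^{(k)}\sim f_k^*\boldsymbol\sigma_k(D_k),\,k\in\mathcal N}\big[J^D\big((\pi^{(l)}_l)_{l\in\mathcal N}\big)\big]\Big]\Big].\] For $\mu\in\Delta(\Pi^D)$ let $\mathbb P_\mu$ be the law of an episode in which first $\pi\sim\mu$ is drawn and then followed. For $\mu_i\in\Delta(\Pi_i)$, the local policy $\pi_i^{\mu_i}$ is $\pi_i^{\mu_i}(a\mid\tau_{i,t})=\mathbb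 P_{\mu_i\otimes\mu_{-i}}(A_{i,t}=a\mid\overline{AO}_{i,t}=\tau_{i,t})$ for any product distribution $\mu_{-i}$ over the other agents' local policies for which the condition has positive probability, and $1/|\mathcal A_i|$ if there is none. The symmetrizer $\Psi:\Pi^D\to\Pi^D$ is $\Psi_i(\pi)=\pi_i^{\mu_i}$, where $\mu_i$ is the $i$-th marginal of the other-play distribution $\mu=|\mathrm{Aut}(D)|^{-N}\sum_{\mathbf g\in\mathrm{Aut}(D)^{\mathcal N}}\delta_{((\mathbf g_i^*\pi)_i)_{i\in\mathcal N}}$ of $\pi$. Policies $\pi,\pi'\in\Pi^D$ are equivalent, $\pi\equiv_D\pi'$, if $\Psi(\pi)=\Psi(\pi')$. \textbf{Theorem.} Let $D$ be a Dec-POMDP, let $\boldsymbol\sigma_1,\dots,\boldsymbol\sigma_N\in\Sigma^{\mathcal D}$, and for every $E\in\mathcal D$ choose $f_{E,D}\in\mathrm{Iso}(E,D)$ arbitrarily. Then \[U^D(\boldsymbol\sigma)=\mathbb E_{D_i\sim\mathcal U(\mathcal D),\,i\in\mathcal N}\Big[\mathbb E_{\pi^{(j)}\sim f_{D_j,D}^*\boldsymbol\sigma_j(D_j),\,j\in\mathcal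 N}\Big[J^D\big((\Psi_k(\pi^{(k)}))_{k\in\mathcal N}\big)\Big]\Big].\] In particular, the payoff depends only on equivalence classes: if $\rho^{(1)},\dots,\rho^{(N)}\in\Pi^D$ are such that for all $k\in\mathcal N$ and $E\in\mathcal D$, $f_{E,D}^*p\equiv_D\rho^{(k)}$ for $\boldsymbol\sigma_k(E)$-almost every $p$, then $U^D(\boldsymbol\sigma)=J^D\big((\Psi_k(\rho^{(k)}))_{k\in\mathcal N}\big)$. (If all $\rho^{(k)}$ equal one policy $\rho$, this value is $J^D(\Psi(\rho))$.) -/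

import Mathlib

open MeasureTheory
open scoped BigOperators ENNReal

universe u v w

noncomputable section

/-- A finite-horizon Dec-POMDP. `Δ(X)` for a finite set `X` is `stdSimplex ℝ X`. The agents are the
elements of `Fin N`; a joint action (observation) is a dependent function on the agents. The time
steps are `0, …, T`. -/
structure DecPOMDP : Type (u + 1) where
  N : ℕ
  State : Type u
  [fintypeState : Fintype State]
  Act : Fin N → Type u
  [fintypeAct : ∀ i, Fintype (Act i)]
  Obs : Fin N → Type u
  [fintypeObs : ∀ i, Fintype (Obs i)]
  /-- `trans s a s'` is `P(s' ∣ s, a)`. -/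
  trans : State → (∀ i, Act i) → stdSimplex ℝ State
  reward : State → (∀ i, Act i) → ℝ
  /-- `obsKer s a o` is `O(o ∣ s, a)`, with `s` the new state and `a` the previous joint action. -/
  obsKer : State → (∀ i, Act i) → stdSimplex ℝ (∀ i, Obs i)
  init : stdSimplex ℝ State
  T : ℕ

/-- Transport of a probability mass function along a bijection: `y ↦ p (e⁻¹ y)`. -/
def simplexMap {X : Type v} {Y : Type w} [Fintype X] [Fintype Y] (e : X ≃ Y)
    (p : stdSimplex ℝ X) : stdSimplex ℝ Y :=
  ⟨fun y => p (e.symm y), fun y => p.2.1 _, by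
    rw [Equiv.sum_comp e.symm (fun x => p x)]; exact p.2.2⟩

/-- The uniform distribution on a nonempty finite set. -/
def uniformSimplex (X : Type v) [Fintype X] [Nonempty X] : stdSimplex ℝ X :=
  ⟨fun _ => 1 / (Fintype.card X : ℝ), fun _ => by positivity, by
    simp [Finset.sum_const, Finset.card_univ]⟩

namespace DecPOMDP

attribute [instance] fintypeState fintypeAct fintypeObs

/-- Joint actions. -/
abbrev JAct (D : DecPOMDP.{u}) : Type u := ∀ i, D.Act i

/-- Joint observations. -/
abbrev JObs (D : DecPOMDP.{u}) : Type u := ∀ i, D.Obs i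

/-- Action-observation histories of agent `i` of length `t`; entry `k` is the pair
`(A_{i,k}, O_{i,k+1})`. -/
abbrev AOHist (D : DecPOMDP.{u}) (i : Fin D.N) (t : ℕ) : Type u :=
  Fin t → D.Act i × D.Obs i

/-- Local policies of agent `i`: `π_i t τ a` is `π_i(a ∣ τ)` for a history `τ` of length `t ≤ T`.
The σ-algebra is the Borel one, inherited from the product of copies of `ℝ`. -/
abbrev LocalPolicy (D : DecPOMDP.{u}) (i : Fin D.N) : Type u :=
  (t : Fin (D.T + 1)) → D.AOHist i t → stdSimplex ℝ (D.Act i)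

/-- Joint policies, with the product σ-algebra. -/
abbrev Policy (D : DecPOMDP.{u}) : Type u := (i : Fin D.N) → D.LocalPolicy i

/-- The sample space `Ω`: all states `S_0, …, S_T`, joint actions `A_0, …, A_T` and joint
observations `O_1, …, O_T` of an episode (entry `k` of the last component is `O_{k+1}`). The rewards
are functions of these. -/
abbrev Traj (D : DecPOMDP.{u}) : Type u :=
  (Fin (D.T + 1) → D.State) × (Fin (D.T + 1) → D.JAct) × (Fin D.T → D.JObs)

/-- The action-observation history of agent `i` at time `t` in the episode `ω`. -/
def aoHist {D : DecPOMDP.{u}} (ω : D.Traj) (i : Fin D.N) (t : Fin (D.T + 1)) : D.AOHist i t :=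
  fun k => (ω.2.1 ⟨k, by omega⟩ i, ω.2.2 ⟨k, by omega⟩ i)

/-- `ℙ_π({ω})`: the state `S_0` is drawn from the initial distribution, each `S_{t+1}` from
`P(· ∣ S_t, A_t)`, each `O_{t+1}` from `O(· ∣ S_{t+1}, A_t)`, and each `A_{i,t}` from
`π_i(· ∣ AO_{i,t})`, independently over the agents `i`. -/
def trajProb {D : DecPOMDP.{u}} (π : D.Policy) (ω : D.Traj) : ℝ :=
  D.init (ω.1 0) *
    (∏ t : Fin D.T, D.trans (ω.1 t.castSucc) (ω.2.1 t.castSucc) (ω.1 t.succ) *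
      D.obsKer (ω.1 t.succ) (ω.2.1 t.castSucc) (ω.2.2 t)) *
    ∏ t : Fin (D.T + 1), ∏ i : Fin D.N, π i t (aoHist ω i t) (ω.2.1 t i)

/-- The self-play objective `J^D(π) = 𝔼_π[∑_{t=0}^T R(S_t, A_t)]`. -/
def J {D : DecPOMDP.{u}} (π : D.Policy) : ℝ :=
  ∑ ω : D.Traj, trajProb π ω * ∑ t : Fin (D.T + 1), D.reward (ω.1 t) (ω.2.1 t)

/-! ### Isomorphisms, pushforward, relabelings -/

/-- Dec-POMDP isomorphisms. The joint map `f_A`, `(f_A a)_{f_N i} = f_{A_i} (a_i)`, is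
`Equiv.piCongr fN fA`, and similarly for observations. -/
structure Iso (D : DecPOMDP.{u}) (E : DecPOMDP.{v}) where
  fN : Fin D.N ≃ Fin E.N
  fS : D.State ≃ E.State
  fA : ∀ i, D.Act i ≃ E.Act (fN i)
  fO : ∀ i, D.Obs i ≃ E.Obs (fN i)
  horizon_eq : D.T = E.T
  trans_eq : ∀ s a s', D.trans s a s' = E.trans (fS s) (Equiv.piCongr fN fA a) (fS s')
  obs_eq : ∀ s a o, D.obsKer s a o =
    E.obsKer (fS s) (Equiv.piCongr fN fA a) (Equiv.piCongr fN fO o)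
  reward_eq : ∀ s a, D.reward s a = E.reward (fS s) (Equiv.piCongr fN fA a)
  init_eq : ∀ s, D.init s = E.init (fS s)

instance (D : DecPOMDP.{u}) (E : DecPOMDP.{v}) : Finite (Iso D E) := by
  refine Finite.of_injective
    (β := Σ e : Fin D.N ≃ Fin E.N, (D.State ≃ E.State) × (∀ i, D.Act i ≃ E.Act (e i)) ×
      (∀ i, D.Obs i ≃ E.Obs (e i))) (fun f => ⟨f.fN, f.fS, f.fA, f.fO⟩) ?_
  rintro ⟨a, b, c, d, _⟩ ⟨a', b', c', d', _⟩ h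
  simp only [Sigma.mk.injEq] at h
  obtain ⟨rfl, h⟩ := h
  simp only [heq_eq_eq, Prod.mk.injEq] at h
  obtain ⟨rfl, rfl, rfl⟩ := h
  rfl

instance (D : DecPOMDP.{u}) (E : DecPOMDP.{v}) : Fintype (Iso D E) := Fintype.ofFinite _

/-- Automorphisms. -/
abbrev Aut (D : DecPOMDP.{u}) : Type u := Iso D D

lemma piCongr_refl {n : ℕ} {X : Fin n → Type u} (x : ∀ i, X i) :
    Equiv.piCongr (W := X) (Z := X) (Equiv.refl _) (fun i => Equiv.refl (X i)) x = x := by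
  funext i
  exact Equiv.piCongr_apply_apply (W := X) (Z := X) (Equiv.refl _) (fun i => Equiv.refl (X i)) x i

instance (D : DecPOMDP.{u}) : Nonempty (Aut D) :=
  ⟨{ fN := Equiv.refl _
     fS := Equiv.refl _
     fA := fun i => Equiv.refl _
     fO := fun i => Equiv.refl _
     horizon_eq := rfl
     trans_eq := fun s a s' => by rw [piCongr_refl]; rfl
     obs_eq := fun s a o => by rw [piCongr_refl, piCongr_refl]; rfl
     reward_eq := fun s a => by rw [piCongr_refl]; rfl
     init_eq := fun s => rfl }⟩

namespace Iso

variable {D : DecPOMDP.{u}} {E : DecPOMDP.{v}}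

/-- The local policy of agent `f i` obtained from a local policy of agent `i` by precomposition with
`f⁻¹`: `(a ∣ τ) ↦ π_i(f⁻¹ a ∣ f⁻¹ τ)`. -/
def pushLocal (f : Iso D E) (i : Fin D.N) (p : D.LocalPolicy i) : E.LocalPolicy (f.fN i) :=
  fun t τ => simplexMap (f.fA i)
    (p (Fin.cast (congrArg (· + 1) f.horizon_eq.symm) t)
      (fun k => ((f.fA i).symm (τ k).1, (f.fO i).symm (τ k).2)))

/-- The pushforward policy `f^*π`: agent `f i` gets the local policy of `i`, precomposed with
`f⁻¹`. -/
def push (f : Iso D E) (π : D.Policy) : E.Policy :=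
  Equiv.piCongrLeft (fun j => E.LocalPolicy j) f.fN (fun i => f.pushLocal i (π i))

lemma push_apply (f : Iso D E) (π : D.Policy) (i : Fin D.N) :
    f.push π (f.fN i) = f.pushLocal i (π i) :=
  Equiv.piCongrLeft_apply_apply (fun j => E.LocalPolicy j) f.fN _ i

lemma measurable_push (f : Iso D E) : Measurable (f.push : D.Policy → E.Policy) := by
  refine measurable_pi_lambda _ fun j => ?_
  obtain ⟨i, rfl⟩ := f.fN.surjective j
  simp only [push_apply]
  refine measurable_pi_lambda _ fun t => measurable_pi_lambda _ fun τ => ?_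
  refine Measurable.subtype_mk (measurable_pi_lambda _ fun a => ?_)
  have h1 : Measurable fun π : D.Policy =>
      π i (Fin.cast (congrArg (· + 1) f.horizon_eq.symm) t)
        (fun k => ((f.fA i).symm (τ k).1, (f.fO i).symm (τ k).2)) := by
    fun_prop
  exact (measurable_pi_apply _).comp (measurable_subtype_coe.comp h1)

/-- The pushforward `f^*ν = ν ∘ (f^*)⁻¹` of a distribution over policies. -/
def pushDist (f : Iso D E) (ν : ProbabilityMeasure D.Policy) : ProbabilityMeasure E.Policy :=
  ν.map f.measurable_push.aemeasurable

end Iso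

/-- Labelings of `D`; `{1, …, k}` is represented by `Fin k`. -/
structure Labeling (D : DecPOMDP.{u}) where
  fN : Fin D.N ≃ Fin D.N
  fS : D.State ≃ Fin (Fintype.card D.State)
  fA : ∀ i, D.Act i ≃ Fin (Fintype.card (D.Act i))
  fO : ∀ i, D.Obs i ≃ Fin (Fintype.card (D.Obs i))

namespace Labeling

variable {D : DecPOMDP.{u}}

instance : Finite (Labeling D) := by
  refine Finite.of_injective (fun f => (f.fN, f.fS, f.fA, f.fO)) ?_
  rintro ⟨a, b, c, d⟩ ⟨a', b', c', d'⟩ h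
  simp only [Prod.mk.injEq] at h
  obtain ⟨rfl, rfl, rfl, rfl⟩ := h
  rfl

instance : Nonempty (Labeling D) :=
  ⟨⟨Equiv.refl _, Fintype.equivFin _, fun _ => Fintype.equivFin _, fun _ => Fintype.equivFin _⟩⟩

/-- `f⁻¹` on joint actions of the relabeled problem. -/
def invA (f : Labeling D) :
    (∀ i, Fin (Fintype.card (D.Act (f.fN.symm i)))) ≃ D.JAct :=
  Equiv.piCongr f.fN.symm (fun i => (f.fA (f.fN.symm i)).symm)

/-- `f⁻¹` on joint observations of the relabeled problem. -/
def invO (f : Labeling D) :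
    (∀ i, Fin (Fintype.card (D.Obs (f.fN.symm i)))) ≃ D.JObs :=
  Equiv.piCongr f.fN.symm (fun i => (f.fO (f.fN.symm i)).symm)

/-- The relabeled Dec-POMDP `f^*D`. -/
def relabel (f : Labeling D) : DecPOMDP.{0} where
  N := D.N
  State := Fin (Fintype.card D.State)
  Act i := Fin (Fintype.card (D.Act (f.fN.symm i)))
  Obs i := Fin (Fintype.card (D.Obs (f.fN.symm i)))
  trans s a := simplexMap f.fS (D.trans (f.fS.symm s) (f.invA a))
  reward s a := D.reward (f.fS.symm s) (f.invA a)
  obsKer s a := simplexMap f.invO.symm (D.obsKer (f.fS.symm s) (f.invA a))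
  init := simplexMap f.fS D.init
  T := D.T

/-- `f⁻¹` is an isomorphism from `f^*D` to `D`. -/
def isoInv (f : Labeling D) : Iso f.relabel D where
  fN := f.fN.symm
  fS := f.fS.symm
  fA i := (f.fA (f.fN.symm i)).symm
  fO i := (f.fO (f.fN.symm i)).symm
  horizon_eq := rfl
  trans_eq _ _ _ := rfl
  obs_eq _ _ _ := rfl
  reward_eq _ _ := rfl
  init_eq _ := rfl

end Labeling

/-- The set of all relabeled Dec-POMDPs of `D`. -/
def relabeled (D : DecPOMDP.{u}) : Set DecPOMDP.{0} :=
  {E | ∃ f : Labeling D, E = f.relabel}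

instance (D : DecPOMDP.{u}) : Finite D.relabeled :=
  ((Set.finite_range (Labeling.relabel (D := D))).subset (by
    rintro E ⟨f, rfl⟩; exact ⟨f, rfl⟩)).to_subtype

instance (D : DecPOMDP.{u}) : Fintype D.relabeled := Fintype.ofFinite _

/-! ### The label-free coordination game -/

/-- Learning algorithms for a set of Dec-POMDPs. -/
abbrev LearningAlg (C : Set DecPOMDP.{u}) : Type (u + 1) :=
  (E : C) → ProbabilityMeasure E.1.Policy

/-- The common payoff `U^D(σ)` of the label-free coordination game for `D`. `𝔼` is the average over
a finite type, i.e. the expectation under the uniform distribution; independent draws by the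
principals are draws of a function of the principals. -/
def payoff (D : DecPOMDP.{u}) (σ : Fin D.N → LearningAlg D.relabeled) : ℝ :=
  𝔼 d : Fin D.N → D.relabeled, 𝔼 f : (∀ j, Iso (d j).1 D),
    ∫ π : Fin D.N → D.Policy, J (fun l => π l l)
      ∂(Measure.pi fun k => ((f k).pushDist (σ k (d k)) : Measure D.Policy))

/-! ### Policies corresponding to distributions, and the symmetrizer -/

/-- `ℙ_μ(Q)` for an event `Q ⊆ Ω`, when a joint policy is drawn from `μ` at the beginning of an
episode and then followed. -/
def mixProb {D : DecPOMDP.{u}} (μ : Measure D.Policy) (Q : Set D.Traj) : ℝ :=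
  ∑ ω : D.Traj, Q.indicator (fun ω => ∫ π, trajProb π ω ∂μ) ω

/-- The event `{AO_{i,t} = τ}`. -/
def evAO {D : DecPOMDP.{u}} (i : Fin D.N) (t : Fin (D.T + 1)) (τ : D.AOHist i t) : Set D.Traj :=
  {ω | aoHist ω i t = τ}

/-- The event `{A_{i,t} = a}`. -/
def evAct {D : DecPOMDP.{u}} (i : Fin D.N) (t : Fin (D.T + 1)) (a : D.Act i) : Set D.Traj :=
  {ω | ω.2.1 t i = a}

lemma trajProb_nonneg {D : DecPOMDP.{u}} (π : D.Policy) (ω : D.Traj) : 0 ≤ trajProb π ω :=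
  mul_nonneg (mul_nonneg (D.init.2.1 _) (Finset.prod_nonneg fun _ _ =>
    mul_nonneg ((D.trans _ _).2.1 _) ((D.obsKer _ _).2.1 _)))
    (Finset.prod_nonneg fun _ _ => Finset.prod_nonneg fun _ _ => (π _ _ _).2.1 _)

lemma mixProb_nonneg {D : DecPOMDP.{u}} (μ : Measure D.Policy) (Q : Set D.Traj) :
    0 ≤ mixProb μ Q :=
  Finset.sum_nonneg fun _ _ => Set.indicator_nonneg
    (fun _ _ => integral_nonneg fun _ => trajProb_nonneg _ _) _

lemma sum_mixProb_evAct {D : DecPOMDP.{u}} (μ : Measure D.Policy) (Q : Set D.Traj)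
    (i : Fin D.N) (t : Fin (D.T + 1)) :
    ∑ a, mixProb μ (evAct i t a ∩ Q) = mixProb μ Q := by
  classical
  unfold mixProb
  rw [Finset.sum_comm]
  refine Finset.sum_congr rfl fun ω _ => ?_
  rw [Finset.sum_eq_single (ω.2.1 t i)]
  · simp [Set.indicator, evAct]
  · intro a _ ha
    simp [Set.indicator, evAct, ha.symm]
  · simp

/-- The conditional distribution `ℙ_μ(A_{i,t} = · ∣ Q)` for an event `Q` of positive probability. -/
def condAct {D : DecPOMDP.{u}} (μ : Measure D.Policy) (Q : Set D.Traj) (hQ : 0 < mixProb μ Q)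
    (i : Fin D.N) (t : Fin (D.T + 1)) : stdSimplex ℝ (D.Act i) :=
  ⟨fun a => mixProb μ (evAct i t a ∩ Q) / mixProb μ Q,
    fun _ => div_nonneg (mixProb_nonneg _ _) (mixProb_nonneg _ _), by
      rw [← Finset.sum_div, sum_mixProb_evAct, div_self hQ.ne']⟩

lemma nonempty_act {D : DecPOMDP.{u}} {i : Fin D.N} (μ : ProbabilityMeasure (D.LocalPolicy i)) :
    Nonempty (D.Act i) := by
  obtain ⟨p⟩ := nonempty_of_isProbabilityMeasure (μ : Measure (D.LocalPolicy i))
  by_contra h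
  rw [not_nonempty_iff] at h
  have := (p 0 (fun k => k.elim0)).2.2
  simp at this

open Classical in
/-- The local policy `π_i^{μ_i}` corresponding to a distribution `μ_i` over local policies of agent
`i`: the conditional distribution of `A_{i,t}` given `AO_{i,t} = τ` under `ℙ_{μ_i ⊗ μ_{-i}}`, for any
`μ_{-i}` with independent local policies that gives the condition positive probability, and the
uniform distribution if there is no such `μ_{-i}`. Here `μ_i ⊗ μ_{-i}` is the product of a family
`ν` of distributions over the local policies of all agents with `ν i = μ_i`. -/
def localOfDist {D : DecPOMDP.{u}} (i : Fin D.N) (μi : ProbabilityMeasure (D.LocalPolicy i)) :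
    D.LocalPolicy i :=
  fun t τ =>
    if h : ∃ ν : ∀ j, ProbabilityMeasure (D.LocalPolicy j), ν i = μi ∧
        0 < mixProb (Measure.pi fun j => (ν j : Measure (D.LocalPolicy j))) (evAO i t τ) then
      condAct (Measure.pi fun j => (h.choose j : Measure (D.LocalPolicy j))) (evAO i t τ)
        h.choose_spec.2 i t
    else
      haveI := nonempty_act μi
      uniformSimplex (D.Act i)

/-- For a profile `φ` of automorphisms, the joint policy `φ^*π` in which agent `i` has the local
policy `proj_i (φ_i^* π)`. -/
def profilePush {D : DecPOMDP.{u}} (φ : Fin D.N → Aut D) (π : D.Policy) : D.Policy :=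
  fun i => (φ i).push π i

/-- The other-play distribution `|Aut(D)|^{-N} ∑_φ δ_{φ^*π}` of `π`. -/
def opDist {D : DecPOMDP.{u}} (π : D.Policy) : ProbabilityMeasure D.Policy :=
  ⟨((Fintype.card (Aut D) : ℝ≥0∞) ^ D.N)⁻¹ •
      ∑ φ : Fin D.N → Aut D, Measure.dirac (profilePush φ π), ⟨by
    have h0 : (Fintype.card (Aut D) : ℝ≥0∞) ≠ 0 := by simp
    have h1 : (Fintype.card (Aut D) : ℝ≥0∞) ≠ ⊤ := by simp
    simp only [Measure.smul_apply, Measure.finsetSum_apply, measure_univ, Finset.sum_const,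
      Finset.card_univ, Fintype.card_pi, Finset.prod_const, Fintype.card_fin, smul_eq_mul,
      nsmul_eq_mul, mul_one, Nat.cast_pow]
    exact ENNReal.inv_mul_cancel (pow_ne_zero _ h0) (ENNReal.pow_ne_top h1)⟩⟩

/-- The symmetrizer `Ψ^D`: `Ψ_i(π)` is the local policy corresponding to the `i`-th marginal of the
other-play distribution of `π`. -/
def symmetrizer {D : DecPOMDP.{u}} (π : D.Policy) : D.Policy :=
  fun i => localOfDist i ((opDist π).map (measurable_pi_apply i).aemeasurable)

/-- Equivalence of joint policies: they have the same symmetrization. -/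
def Equivalent {D : DecPOMDP.{u}} (π π' : D.Policy) : Prop :=
  symmetrizer π = symmetrizer π'

end DecPOMDP

end

/-! Two facts carry the theorem.

The first is that mixing over local policies can be absorbed into behaviour
(`polWeight_localOfDist`). The probability of an episode is an environment factor times one factor
`polWeight` per agent, and the factor of agent `i` up to time `n` depends on `i`'s history alone.
Under a product distribution the probability of a history therefore splits into the mean of
`polWeight` and a remainder `othersWeight` due to everything else. The remainder cancels in the
conditional probability of the next action, so `localOfDist` does not depend on the chosen
opponents. A telescoping product shows that it reproduces the mean of `polWeight` along every
episode that the environment allows. Applied to the marginals of other-play distributions, this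
writes each agent's factor as an average over `Aut D`. A product of such averages is an average over
profiles, so `J` of the symmetrizations is the average of `J` over independent automorphisms
(`J_symmetrizer`).

The second is that `Iso E D` is a torsor under `Aut D`. Once some `f : Iso E D` is fixed, a uniform
isomorphism is `f` followed by a uniform automorphism (`Iso.transEquiv`), and pushforward is
functorial. Averaging over isomorphisms is thus averaging over automorphisms after transport along
`f`, which the first fact turns into symmetrization (`expect_iso_integral_J`). The statement on
equivalence classes follows because the integrand is then almost surely constant. -/

namespace DecPOMDP

noncomputable section

/-! ### Summing out coordinates -/

/-- Resampling a coordinate `val` of a finite sample space, where `upd ω y` replaces the coordinate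
of `ω` by `y`. -/
lemma sum_sum_update {Ω : Type v} {Y : Type w} [Fintype Ω] [Fintype Y] (upd : Ω → Y → Ω)
    (val : Ω → Y) (hval : ∀ ω y, val (upd ω y) = y) (hupd : ∀ ω y, upd (upd ω y) (val ω) = ω)
    (F : Ω → ℝ) : ∑ ω, ∑ y, F (upd ω y) = Fintype.card Y * ∑ ω, F ω := by
  -- Swapping the stored coordinate with the fresh value is an involution of `Ω × Y`. Reindexing by
  -- it makes the summand independent of the second component.
  have hinv : Function.Involutive fun z : Ω × Y => (upd z.1 z.2, val z.1) := by
    rintro ⟨ω, y⟩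
    simp [hval, hupd]
  have h := Equiv.sum_comp hinv.toPerm fun z : Ω × Y => F z.1
  simp only [Function.Involutive.coe_toPerm, Fintype.sum_prod_type] at h
  rw [h, Finset.mul_sum]
  simp

/-- A conditional weight `k` on a coordinate can be summed out against a function `h` that does not
depend on the coordinate. -/
lemma sum_mul_eq_sum_mul_sum_update {Ω : Type v} {Y : Type w} [Fintype Ω] [Fintype Y]
    (upd : Ω → Y → Ω) (val : Ω → Y) (hval : ∀ ω y, val (upd ω y) = y)
    (hupd : ∀ ω y, upd (upd ω y) (val ω) = ω) (h k : Ω → ℝ) (hh : ∀ ω y, h (upd ω y) = h ω) :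
    ∑ ω, h ω * k ω = (Fintype.card Y : ℝ)⁻¹ * ∑ ω, h ω * ∑ y, k (upd ω y) := by
  rcases isEmpty_or_nonempty Ω with hΩ | ⟨⟨ω₀⟩⟩
  · simp
  have : Nonempty Y := ⟨val ω₀⟩
  have hc : (Fintype.card Y : ℝ) ≠ 0 := by simp
  rw [eq_inv_mul_iff_mul_eq₀ hc, ← sum_sum_update upd val hval hupd]
  simp only [hh, Finset.mul_sum]

variable {D : DecPOMDP.{u}}

/-- Replace the state at time `t`. -/
def updState (t : Fin (D.T + 1)) (ω : D.Traj) (s : D.State) : D.Traj :=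
  (Function.update ω.1 t s, ω.2.1, ω.2.2)

/-- Replace the joint action at time `t`. -/
def updAct (t : Fin (D.T + 1)) (ω : D.Traj) (a : D.JAct) : D.Traj :=
  (ω.1, Function.update ω.2.1 t a, ω.2.2)

/-- Replace the joint observation that follows time `t`. -/
def updObs (t : Fin D.T) (ω : D.Traj) (o : D.JObs) : D.Traj :=
  (ω.1, ω.2.1, Function.update ω.2.2 t o)

lemma sum_mul_updState (t : Fin (D.T + 1)) (h k : D.Traj → ℝ)
    (hh : ∀ ω s, h (updState t ω s) = h ω) :
    ∑ ω, h ω * k ω = (Fintype.card D.State : ℝ)⁻¹ * ∑ ω, h ω * ∑ s, k (updState t ω s) :=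
  sum_mul_eq_sum_mul_sum_update (updState t) (fun ω => ω.1 t) (by simp [updState])
    (by simp [updState]) h k hh

lemma sum_mul_updAct (t : Fin (D.T + 1)) (h k : D.Traj → ℝ)
    (hh : ∀ ω a, h (updAct t ω a) = h ω) :
    ∑ ω, h ω * k ω = (Fintype.card D.JAct : ℝ)⁻¹ * ∑ ω, h ω * ∑ a, k (updAct t ω a) :=
  sum_mul_eq_sum_mul_sum_update (updAct t) (fun ω => ω.2.1 t) (by simp [updAct])
    (by simp [updAct]) h k hh

lemma sum_mul_updObs (t : Fin D.T) (h k : D.Traj → ℝ)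
    (hh : ∀ ω o, h (updObs t ω o) = h ω) :
    ∑ ω, h ω * k ω = (Fintype.card D.JObs : ℝ)⁻¹ * ∑ ω, h ω * ∑ o, k (updObs t ω o) :=
  sum_mul_eq_sum_mul_sum_update (updObs t) (fun ω => ω.2.2 t) (by simp [updObs])
    (by simp [updObs]) h k hh

/-! ### Prefixes of an episode -/

/-- The episodes agree on the states up to time `n` and on the actions and observations of the
first `n` steps. -/
def PrefixEq (n : ℕ) (ω ω' : D.Traj) : Prop :=
  (∀ t : Fin (D.T + 1), t.val ≤ n → ω.1 t = ω'.1 t) ∧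
    (∀ t : Fin (D.T + 1), t.val < n → ω.2.1 t = ω'.2.1 t) ∧
    ∀ t : Fin D.T, t.val < n → ω.2.2 t = ω'.2.2 t

lemma PrefixEq.mono {m n : ℕ} (hmn : m ≤ n) {ω ω' : D.Traj} (h : PrefixEq n ω ω') :
    PrefixEq m ω ω' :=
  ⟨fun t ht => h.1 t (ht.trans hmn), fun t ht => h.2.1 t (ht.trans_le hmn),
    fun t ht => h.2.2 t (ht.trans_le hmn)⟩

lemma prefixEq_updState {n : ℕ} {t : Fin (D.T + 1)} (ht : n < t.val) (ω : D.Traj) (s : D.State) :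
    PrefixEq n (updState t ω s) ω :=
  ⟨fun r hr => Function.update_of_ne (by rintro rfl; omega) _ _, fun _ _ => rfl, fun _ _ => rfl⟩

lemma prefixEq_updAct {n : ℕ} {t : Fin (D.T + 1)} (ht : n ≤ t.val) (ω : D.Traj) (a : D.JAct) :
    PrefixEq n (updAct t ω a) ω :=
  ⟨fun _ _ => rfl, fun r hr => Function.update_of_ne (by rintro rfl; omega) _ _, fun _ _ => rfl⟩

lemma prefixEq_updObs {n : ℕ} {t : Fin D.T} (ht : n ≤ t.val) (ω : D.Traj) (o : D.JObs) :
    PrefixEq n (updObs t ω o) ω :=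
  ⟨fun _ _ => rfl, fun _ _ => rfl, fun r hr => Function.update_of_ne (by rintro rfl; omega) _ _⟩

/-- A history at time `t` contains only actions and observations of steps before `t`, so `t = n` is
allowed although the `n`-th action is free. -/
lemma PrefixEq.aoHist_eq {n : ℕ} {ω ω' : D.Traj} (h : PrefixEq n ω ω') (i : Fin D.N)
    {t : Fin (D.T + 1)} (ht : t.val ≤ n) : aoHist ω i t = aoHist ω' i t := by
  funext k
  have hk := k.2
  simp only [aoHist]
  rw [h.2.1 ⟨k, by omega⟩ (hk.trans_le ht), h.2.2 ⟨k, by omega⟩ (hk.trans_le ht)]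

/-- The probability of the `t`-th transition and observation; it is `1` after the horizon. -/
def envStep (t : ℕ) (ω : D.Traj) : ℝ :=
  if h : t < D.T then
    D.trans (ω.1 (Fin.castSucc ⟨t, h⟩)) (ω.2.1 (Fin.castSucc ⟨t, h⟩)) (ω.1 (Fin.succ ⟨t, h⟩)) *
      D.obsKer (ω.1 (Fin.succ ⟨t, h⟩)) (ω.2.1 (Fin.castSucc ⟨t, h⟩)) (ω.2.2 ⟨t, h⟩)
  else 1

/-- The probability that the environment contributes to the first `n` steps. -/
def envWeight (n : ℕ) (ω : D.Traj) : ℝ :=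
  D.init (ω.1 0) * ∏ t ∈ Finset.range n, envStep t ω

/-- The probability of the `t`-th action of agent `i`; it is `1` after the horizon. -/
def polStep (i : Fin D.N) (t : ℕ) (p : D.LocalPolicy i) (ω : D.Traj) : ℝ :=
  if h : t < D.T + 1 then p ⟨t, h⟩ (aoHist ω i ⟨t, h⟩) (ω.2.1 ⟨t, h⟩ i) else 1

/-- The probability that agent `i` contributes to the first `n` steps. -/
def polWeight (i : Fin D.N) (n : ℕ) (p : D.LocalPolicy i) (ω : D.Traj) : ℝ :=
  ∏ t ∈ Finset.range n, polStep i t p ω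

/-- The probability of the first `n` steps. -/
def prefixProb (n : ℕ) (π : D.Policy) (ω : D.Traj) : ℝ :=
  envWeight n ω * ∏ i, polWeight i n (π i) ω

lemma envWeight_succ (n : ℕ) (ω : D.Traj) :
    envWeight (n + 1) ω = envWeight n ω * envStep n ω := by
  simp only [envWeight, Finset.prod_range_succ, mul_assoc]

lemma polWeight_succ (i : Fin D.N) (n : ℕ) (p : D.LocalPolicy i) (ω : D.Traj) :
    polWeight i (n + 1) p ω = polWeight i n p ω * polStep i n p ω :=
  Finset.prod_range_succ _ _

lemma polStep_fin (i : Fin D.N) (t : Fin (D.T + 1)) (p : D.LocalPolicy i) (ω : D.Traj) :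
    polStep i t p ω = p t (aoHist ω i t) (ω.2.1 t i) :=
  dif_pos t.2

/-- There are `T + 1` actions but only `T` transitions, so the last environment factor is the
default value `1`. -/
lemma trajProb_eq_prefixProb (π : D.Policy) (ω : D.Traj) :
    trajProb π ω = prefixProb (D.T + 1) π ω := by
  have h1 : envWeight (D.T + 1) ω = envWeight D.T ω := by
    rw [envWeight_succ, envStep, dif_neg (lt_irrefl _), mul_one]
  rw [prefixProb, h1, envWeight, trajProb, Finset.prod_comm]
  congr 1
  · congr 1
    rw [Finset.prod_range]
    refine Finset.prod_congr rfl fun t _ => ?_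
    rw [envStep, dif_pos t.2]
  · refine Finset.prod_congr rfl fun i _ => ?_
    rw [polWeight, Finset.prod_range]
    exact Finset.prod_congr rfl fun t _ => (polStep_fin i t _ ω).symm

lemma envStep_nonneg (t : ℕ) (ω : D.Traj) : 0 ≤ envStep t ω := by
  unfold envStep
  split_ifs
  · exact mul_nonneg ((D.trans _ _).2.1 _) ((D.obsKer _ _).2.1 _)
  · exact zero_le_one

lemma envWeight_nonneg (n : ℕ) (ω : D.Traj) : 0 ≤ envWeight n ω :=
  mul_nonneg (D.init.2.1 _) (Finset.prod_nonneg fun _ _ => envStep_nonneg _ _)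

lemma polStep_nonneg (i : Fin D.N) (t : ℕ) (p : D.LocalPolicy i) (ω : D.Traj) :
    0 ≤ polStep i t p ω := by
  unfold polStep
  split_ifs
  · exact (p _ _).2.1 _
  · exact zero_le_one

lemma polStep_le_one (i : Fin D.N) (t : ℕ) (p : D.LocalPolicy i) (ω : D.Traj) :
    polStep i t p ω ≤ 1 := by
  unfold polStep
  split_ifs
  · exact (mem_Icc_of_mem_stdSimplex (p _ _).2 _).2
  · exact le_rfl

lemma polWeight_nonneg (i : Fin D.N) (n : ℕ) (p : D.LocalPolicy i) (ω : D.Traj) :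
    0 ≤ polWeight i n p ω :=
  Finset.prod_nonneg fun _ _ => polStep_nonneg _ _ _ _

lemma polWeight_le_one (i : Fin D.N) (n : ℕ) (p : D.LocalPolicy i) (ω : D.Traj) :
    polWeight i n p ω ≤ 1 :=
  Finset.prod_le_one (fun _ _ => polStep_nonneg _ _ _ _) fun _ _ => polStep_le_one _ _ _ _

lemma PrefixEq.envWeight_eq {n : ℕ} {ω ω' : D.Traj} (h : PrefixEq n ω ω') :
    envWeight n ω = envWeight n ω' := by
  rw [envWeight, envWeight, h.1 0 (by simp)]
  congr 1
  refine Finset.prod_congr rfl fun t ht => ?_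
  rw [Finset.mem_range] at ht
  unfold envStep
  split_ifs with hT
  · rw [h.1 (Fin.castSucc ⟨t, hT⟩) ht.le, h.2.1 (Fin.castSucc ⟨t, hT⟩) ht,
      h.1 (Fin.succ ⟨t, hT⟩) ht, h.2.2 ⟨t, hT⟩ ht]
  · rfl

/-- The contribution of agent `i` to the first `n` steps depends only on its history. -/
lemma polWeight_eq_of_aoHist_eq {ω ω' : D.Traj} {i : Fin D.N} {n : Fin (D.T + 1)}
    (h : aoHist ω i n = aoHist ω' i n) (p : D.LocalPolicy i) :
    polWeight i n p ω = polWeight i n p ω' := by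
  refine Finset.prod_congr rfl fun t ht => ?_
  rw [Finset.mem_range] at ht
  have hn := n.2
  have ht' : t < D.T + 1 := by omega
  have hpair : ∀ k (hk : k < n.val),
      (ω.2.1 ⟨k, by omega⟩ i, ω.2.2 ⟨k, by omega⟩ i) =
        (ω'.2.1 ⟨k, by omega⟩ i, ω'.2.2 ⟨k, by omega⟩ i) :=
    fun k hk => congrFun h ⟨k, hk⟩
  have hh : aoHist ω i ⟨t, ht'⟩ = aoHist ω' i ⟨t, ht'⟩ := by
    funext k
    exact hpair k (k.2.trans ht)
  unfold polStep
  have ha : ω.2.1 ⟨t, ht'⟩ i = ω'.2.1 ⟨t, ht'⟩ i := (Prod.ext_iff.1 (hpair t ht)).1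
  rw [dif_pos ht', dif_pos ht', hh, ha]

lemma PrefixEq.prefixProb_eq {n : ℕ} (hn : n ≤ D.T) {ω ω' : D.Traj} (h : PrefixEq n ω ω')
    (π : D.Policy) : prefixProb n π ω = prefixProb n π ω' := by
  rw [prefixProb, prefixProb, h.envWeight_eq]
  congr 1
  exact Finset.prod_congr rfl fun i _ =>
    polWeight_eq_of_aoHist_eq (n := ⟨n, by omega⟩) (h.aoHist_eq i le_rfl) (π i)

/-- Summing out the state and observation that follow the `n`-th action. -/
lemma exists_sum_mul_envStep (D : DecPOMDP.{u}) (n : ℕ) : ∃ c : ℝ, 0 < c ∧ ∀ h : D.Traj → ℝ,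
    (∀ ω ω', PrefixEq n ω ω' → (∀ t : Fin (D.T + 1), t.val = n → ω.2.1 t = ω'.2.1 t) →
      h ω = h ω') → ∑ ω, h ω * envStep n ω = c * ∑ ω, h ω := by
  rcases isEmpty_or_nonempty D.Traj with hΩ | ⟨⟨ω₀⟩⟩
  · exact ⟨1, one_pos, fun h _ => by simp⟩
  by_cases hn : n < D.T
  swap
  · exact ⟨1, one_pos, fun h _ => by simp [envStep, hn]⟩
  have : Nonempty D.State := ⟨ω₀.1 0⟩
  have : Nonempty D.JObs := ⟨ω₀.2.2 ⟨n, hn⟩⟩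
  set t : Fin D.T := ⟨n, hn⟩
  have hne : t.succ ≠ t.castSucc := (Fin.castSucc_lt_succ (i := t)).ne'
  -- The sums keep running over complete episodes, so each coordinate that is summed out leaves the
  -- inverse of its number of values.
  refine ⟨(Fintype.card D.JObs : ℝ)⁻¹ * (Fintype.card D.State : ℝ)⁻¹, by positivity,
    fun h hh => ?_⟩
  have e : ∀ ω : D.Traj, h ω * envStep n ω =
      (h ω * D.trans (ω.1 t.castSucc) (ω.2.1 t.castSucc) (ω.1 t.succ)) *
        D.obsKer (ω.1 t.succ) (ω.2.1 t.castSucc) (ω.2.2 t) := fun ω => by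
    rw [envStep, dif_pos hn, mul_assoc]
  simp only [e]
  -- The observation has to go before the state, because its kernel depends on the new state.
  rw [sum_mul_updObs t]
  swap
  · intro ω o
    rw [hh (updObs t ω o) ω (prefixEq_updObs (t := t) le_rfl ω o) fun _ _ => rfl]
    rfl
  have e2 : ∀ ω : D.Traj, ∑ o, D.obsKer ((updObs t ω o).1 t.succ) ((updObs t ω o).2.1 t.castSucc)
      ((updObs t ω o).2.2 t) = 1 := fun ω => by
    simp only [updObs, Function.update_self]
    exact (D.obsKer _ _).2.2
  simp only [e2, mul_one]
  rw [sum_mul_updState t.succ]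
  swap
  · exact fun ω s => hh _ _ (prefixEq_updState (by simp [t]) ω s) fun _ _ => rfl
  have e3 : ∀ ω : D.Traj, ∑ s, D.trans ((updState t.succ ω s).1 t.castSucc)
      ((updState t.succ ω s).2.1 t.castSucc) ((updState t.succ ω s).1 t.succ) = 1 := fun ω => by
    simp only [updState, Function.update_self, Function.update_of_ne hne.symm]
    exact (D.trans _ _).2.2
  simp only [e3, mul_one, mul_assoc]

/-- Summing out the `n`-th action. -/
lemma sum_mul_prod_polStep (n : Fin (D.T + 1)) (π : D.Policy) (h : D.Traj → ℝ)
    (hh : ∀ ω ω', PrefixEq n ω ω' → h ω = h ω') (v : D.JAct → ℝ) :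
    ∑ ω, h ω * ((∏ i, polStep i n (π i) ω) * v (ω.2.1 n)) =
      (Fintype.card D.JAct : ℝ)⁻¹ *
        ∑ ω, h ω * ∑ a : D.JAct, (∏ i, π i n (aoHist ω i n) (a i)) * v a := by
  rw [sum_mul_updAct n h _ fun ω a => hh _ _ (prefixEq_updAct le_rfl ω a)]
  congr 1
  refine Finset.sum_congr rfl fun ω _ => ?_
  congr 1
  refine Finset.sum_congr rfl fun a _ => ?_
  have hact : (updAct n ω a).2.1 n = a := by simp [updAct]
  simp only [polStep_fin, (prefixEq_updAct le_rfl ω a).aoHist_eq _ le_rfl, hact]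

lemma prefixProb_succ (n : ℕ) (π : D.Policy) (ω : D.Traj) :
    prefixProb (n + 1) π ω = prefixProb n π ω * (∏ i, polStep i n (π i) ω) * envStep n ω := by
  simp only [prefixProb, envWeight_succ, polWeight_succ, Finset.prod_mul_distrib]
  ring

/-- Summing out the `n`-th step. -/
lemma exists_sum_prefixProb_succ (n : Fin (D.T + 1)) : ∃ c : ℝ, 0 < c ∧
    ∀ (π : D.Policy) (g : D.Traj → ℝ) (_ : ∀ ω ω', PrefixEq n ω ω' → g ω = g ω')
      (v : D.JAct → ℝ),
      ∑ ω, prefixProb (n + 1) π ω * (g ω * v (ω.2.1 n)) =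
        c * ∑ ω, prefixProb n π ω * g ω *
          ∑ a : D.JAct, (∏ i, π i n (aoHist ω i n) (a i)) * v a := by
  rcases isEmpty_or_nonempty D.Traj with hΩ | ⟨⟨ω₀⟩⟩
  · exact ⟨1, one_pos, fun π g hg v => by simp⟩
  have : Nonempty D.JAct := ⟨ω₀.2.1 n⟩
  obtain ⟨c, hc, hsum⟩ := exists_sum_mul_envStep D n
  refine ⟨c * (Fintype.card D.JAct : ℝ)⁻¹, by positivity, fun π g hg v => ?_⟩
  have hn : (n : ℕ) ≤ D.T := Nat.lt_succ_iff.1 n.2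
  have hh : ∀ ω ω', PrefixEq n ω ω' → prefixProb n π ω * g ω = prefixProb n π ω' * g ω' :=
    fun ω ω' h => by rw [h.prefixProb_eq hn, hg ω ω' h]
  -- Read backwards: the environment step is summed out first, with the `n`-th action fixed, and
  -- then that action.
  rw [mul_assoc, ← sum_mul_prod_polStep n π _ hh v, ← hsum]
  · refine Finset.sum_congr rfl fun ω _ => ?_
    rw [prefixProb_succ]
    ring
  · intro ω ω' h h'
    rw [hh ω ω' h]
    simp only [polStep_fin, h.aoHist_eq _ le_rfl, h' n rfl]

/-- Summing out everything after the first `n` steps. -/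
lemma exists_sum_trajProb_mul (D : DecPOMDP.{u}) {n : ℕ} (hn : n ≤ D.T + 1) : ∃ c : ℝ, 0 < c ∧
    ∀ (π : D.Policy) (g : D.Traj → ℝ) (_ : ∀ ω ω', PrefixEq n ω ω' → g ω = g ω'),
      ∑ ω, trajProb π ω * g ω = c * ∑ ω, prefixProb n π ω * g ω := by
  induction hn using Nat.decreasingInduction with
  | self => exact ⟨1, one_pos, fun π g _ => by simp only [trajProb_eq_prefixProb, one_mul]⟩
  | of_succ k hk ih =>
    obtain ⟨c, hc, hsum⟩ := ih
    obtain ⟨c', hc', hsum'⟩ := exists_sum_prefixProb_succ (D := D) ⟨k, hk⟩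
    refine ⟨c * c', by positivity, fun π g hg => ?_⟩
    rw [hsum π g fun ω ω' h => hg ω ω' (h.mono k.le_succ)]
    have h := hsum' π g hg fun _ => 1
    have hone : ∀ ω : D.Traj, ∑ a : D.JAct, (∏ i, π i ⟨k, hk⟩ (aoHist ω i ⟨k, hk⟩) (a i)) = 1 :=
      fun ω => by
        rw [← Fintype.prod_sum fun i a => π i ⟨k, hk⟩ (aoHist ω i ⟨k, hk⟩) a]
        exact Finset.prod_eq_one fun i _ => (π i _ _).2.2
    simp only [mul_one, hone] at h
    rw [h, mul_assoc]

/-- The constant depends on neither the policy nor the test functions. Hence it can be pulled out of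
integrals over policies, and it cancels in conditional probabilities. -/
lemma exists_sum_trajProb_mul_act (n : Fin (D.T + 1)) : ∃ c : ℝ, 0 < c ∧
    ∀ (π : D.Policy) (g : D.Traj → ℝ) (_ : ∀ ω ω', PrefixEq n ω ω' → g ω = g ω')
      (v : D.JAct → ℝ),
      ∑ ω, trajProb π ω * (g ω * v (ω.2.1 n)) =
        c * ∑ ω, prefixProb n π ω * g ω *
          ∑ a : D.JAct, (∏ i, π i n (aoHist ω i n) (a i)) * v a := by
  obtain ⟨c, hc, hsum⟩ := exists_sum_trajProb_mul D (n := n + 1) n.2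
  obtain ⟨c', hc', hsum'⟩ := exists_sum_prefixProb_succ n
  refine ⟨c * c', by positivity, fun π g hg v => ?_⟩
  rw [hsum, hsum' π g hg v, mul_assoc]
  intro ω ω' h
  rw [hg ω ω' (h.mono (Nat.le_succ _)), h.2.1 n (Nat.lt_succ_self _)]

/-- The probability of a history of agent `i`, and of the next action jointly with it, under a
fixed joint policy. -/
lemma exists_sum_trajProb_indicator (i : Fin D.N) (n : Fin (D.T + 1)) : ∃ c : ℝ, 0 < c ∧
    ∀ (π : D.Policy) (τ : D.AOHist i n),
      (∑ ω, (evAO i n τ).indicator (trajProb π) ω =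
        c * ∑ ω, (evAO i n τ).indicator (prefixProb n π) ω) ∧
      ∀ a, ∑ ω, (evAct i n a ∩ evAO i n τ).indicator (trajProb π) ω =
        c * ∑ ω, (evAO i n τ).indicator (fun ω => prefixProb n π ω * π i n τ a) ω := by
  classical
  obtain ⟨c, hc, hsum⟩ := exists_sum_trajProb_mul_act (D := D) n
  refine ⟨c, hc, fun π τ => ?_⟩
  have hg : ∀ ω ω' : D.Traj, PrefixEq n ω ω' →
      (evAO i n τ).indicator (1 : D.Traj → ℝ) ω = (evAO i n τ).indicator 1 ω' := fun ω ω' h => by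
    have hm : ω ∈ evAO i n τ ↔ ω' ∈ evAO i n τ := by
      change aoHist ω i n = τ ↔ aoHist ω' i n = τ
      rw [h.aoHist_eq i le_rfl]
    by_cases hω : ω' ∈ evAO i n τ
    · rw [Set.indicator_of_mem hω, Set.indicator_of_mem (hm.2 hω), Pi.one_apply, Pi.one_apply]
    · rw [Set.indicator_of_notMem hω, Set.indicator_of_notMem (mt hm.1 hω)]
  constructor
  · have h := hsum π _ hg fun _ => 1
    have hone : ∀ ω : D.Traj, ∑ a : D.JAct, (∏ i, π i n (aoHist ω i n) (a i)) = 1 := fun ω => by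
      rw [← Fintype.prod_sum fun i a => π i n (aoHist ω i n) a]
      exact Finset.prod_eq_one fun i _ => (π i _ _).2.2
    simp only [mul_one, hone] at h
    simpa [Set.indicator] using h
  · intro a
    have h := hsum π _ hg fun b => if b i = a then 1 else 0
    have hone : ∀ ω : D.Traj, ∑ b : D.JAct, (∏ j, π j n (aoHist ω j n) (b j)) *
        (if b i = a then 1 else 0) = π i n (aoHist ω i n) a := fun ω => by
      -- The indicator of agent `i`'s action is spread out as a product over all agents, with factor
      -- `1` for `j ≠ i`, so that the sum over joint actions factors.
      have e : ∀ b : D.JAct, (∏ j, π j n (aoHist ω j n) (b j)) * (if b i = a then (1 : ℝ) else 0) =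
          ∏ j, π j n (aoHist ω j n) (b j) *
            (if hj : j = i then if hj ▸ b j = a then 1 else 0 else 1) := fun b => by
        rw [Finset.prod_mul_distrib]
        congr 1
        rw [Finset.prod_eq_single i]
        · simp
        · intro j _ hj
          simp [hj]
        · simp
      simp only [e]
      rw [← Fintype.prod_sum fun j b => π j n (aoHist ω j n) b *
            (if hj : j = i then if hj ▸ b = a then 1 else 0 else 1), Finset.prod_eq_single i]
      · simp
      · intro j _ hj
        simp [hj]
      · simp
    simp only [hone] at h
    have e1 : ∀ ω, (evAct i n a ∩ evAO i n τ).indicator (trajProb π) ω = trajProb π ω *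
        ((evAO i n τ).indicator 1 ω * if ω.2.1 n i = a then 1 else 0) := fun ω => by
      by_cases h1 : ω.2.1 n i = a <;> by_cases h2 : aoHist ω i n = τ <;>
        simp [Set.indicator, evAct, evAO, h1, h2]
    have e2 : ∀ ω, (evAO i n τ).indicator (fun ω => prefixProb n π ω * π i n τ a) ω =
        prefixProb n π ω * (evAO i n τ).indicator 1 ω * π i n (aoHist ω i n) a := fun ω => by
      by_cases h2 : aoHist ω i n = τ <;> simp [Set.indicator, evAO, h2]
    simp only [e1, e2, h]

/-! ### Integrals over policies -/

lemma measurable_localPolicy_apply {i : Fin D.N} (t : Fin (D.T + 1)) (τ : D.AOHist i t)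
    (a : D.Act i) : Measurable fun p : D.LocalPolicy i => p t τ a := by
  have h1 : Measurable fun p : D.LocalPolicy i => p t τ := by fun_prop
  exact (measurable_pi_apply a).comp (measurable_subtype_coe.comp h1)

lemma measurable_polWeight (i : Fin D.N) (n : ℕ) (ω : D.Traj) :
    Measurable fun p : D.LocalPolicy i => polWeight i n p ω := by
  refine Finset.measurable_fun_prod _ fun t _ => ?_
  unfold polStep
  split_ifs
  · exact measurable_localPolicy_apply _ _ _
  · exact measurable_const

lemma measurable_trajProb (ω : D.Traj) : Measurable fun π : D.Policy => trajProb π ω := by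
  simp only [trajProb_eq_prefixProb, prefixProb]
  exact (Finset.measurable_fun_prod _ fun i _ =>
    (measurable_polWeight i _ ω).comp (measurable_pi_apply i)).const_mul _

lemma measurable_J : Measurable (J : D.Policy → ℝ) :=
  Finset.measurable_fun_sum _ fun ω _ => (measurable_trajProb ω).mul_const _

/-- A bound uniform in the policy, which makes all integrands over policies bounded and hence
integrable. -/
lemma trajProb_le (π : D.Policy) (ω : D.Traj) : trajProb π ω ≤ envWeight (D.T + 1) ω := by
  rw [trajProb_eq_prefixProb]
  exact mul_le_of_le_one_right (envWeight_nonneg _ _)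
    (Finset.prod_le_one (fun _ _ => polWeight_nonneg _ _ _ _) fun _ _ => polWeight_le_one _ _ _ _)

lemma exists_abs_J_le (D : DecPOMDP.{u}) : ∃ C : ℝ, ∀ π : D.Policy, |J π| ≤ C := by
  refine ⟨∑ ω : D.Traj, envWeight (D.T + 1) ω * |∑ t : Fin (D.T + 1), D.reward (ω.1 t) (ω.2.1 t)|,
    fun π => (Finset.abs_sum_le_sum_abs _ _).trans (Finset.sum_le_sum fun ω _ => ?_)⟩
  rw [abs_mul, abs_of_nonneg (trajProb_nonneg π ω)]
  exact mul_le_mul_of_nonneg_right (trajProb_le π ω) (abs_nonneg _)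

lemma integrable_J_comp {Ω : Type v} [MeasurableSpace Ω] (μ : Measure Ω) [IsFiniteMeasure μ]
    {F : Ω → D.Policy} (hF : Measurable F) : Integrable (fun x => J (F x)) μ := by
  obtain ⟨C, hC⟩ := exists_abs_J_le D
  exact Integrable.of_bound (measurable_J.comp hF).aestronglyMeasurable C
    (Filter.Eventually.of_forall fun x => hC (F x))

lemma integrable_polWeight {i : Fin D.N} (μ : Measure (D.LocalPolicy i)) [IsFiniteMeasure μ]
    (n : ℕ) (ω : D.Traj) : Integrable (fun p => polWeight i n p ω) μ :=
  Integrable.of_bound (measurable_polWeight i n ω).aestronglyMeasurable 1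
    (Filter.Eventually.of_forall fun p => by
      rw [Real.norm_of_nonneg (polWeight_nonneg _ _ _ _)]
      exact polWeight_le_one _ _ _ _)

lemma integral_polWeight_nonneg {i : Fin D.N} (μ : Measure (D.LocalPolicy i)) (n : ℕ)
    (ω : D.Traj) : 0 ≤ ∫ p, polWeight i n p ω ∂μ :=
  integral_nonneg fun _ => polWeight_nonneg _ _ _ _

lemma mixProb_eq_integral (μ : Measure D.Policy) [IsFiniteMeasure μ] (Q : Set D.Traj) :
    mixProb μ Q = ∫ π, ∑ ω, Q.indicator (trajProb π) ω ∂μ := by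
  classical
  rw [mixProb, integral_finsetSum]
  · refine Finset.sum_congr rfl fun ω _ => ?_
    by_cases h : ω ∈ Q <;> simp [h]
  · intro ω _
    by_cases h : ω ∈ Q
    · simp only [Set.indicator_of_mem h]
      refine Integrable.of_bound (measurable_trajProb ω).aestronglyMeasurable
        (envWeight (D.T + 1) ω) (Filter.Eventually.of_forall fun π => ?_)
      rw [Real.norm_of_nonneg (trajProb_nonneg _ _)]
      exact trajProb_le π ω
    · simp [h]

/-- The integral of the probability of the first `n` steps, weighted by a function of the local
policy of agent `i`. -/
lemma integral_prefixProb_mul (ν : ∀ j, ProbabilityMeasure (D.LocalPolicy j)) (i : Fin D.N)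
    (n : ℕ) (ω : D.Traj) (ψ : D.LocalPolicy i → ℝ) :
    ∫ π, prefixProb n π ω * ψ (π i) ∂(Measure.pi fun j => (ν j : Measure (D.LocalPolicy j))) =
      (∫ p, polWeight i n p ω * ψ p ∂(ν i : Measure (D.LocalPolicy i))) *
        (envWeight n ω * ∏ j ∈ Finset.univ.erase i,
          ∫ p, polWeight j n p ω ∂(ν j : Measure (D.LocalPolicy j))) := by
  classical
  -- The weight `ψ` is absorbed into the factor of agent `i`, so that the integrand is a product
  -- over agents, as Fubini requires.
  let φ : ∀ j, D.LocalPolicy j → ℝ := fun j p =>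
    polWeight j n p ω * if hj : j = i then ψ (hj ▸ p) else 1
  have e : ∀ π : D.Policy, prefixProb n π ω * ψ (π i) = envWeight n ω * ∏ j, φ j (π j) :=
    fun π => by
      simp only [φ, Finset.prod_mul_distrib, prefixProb, mul_assoc]
      congr 2
      rw [Finset.prod_eq_single i]
      · simp
      · intro j _ hj
        simp [hj]
      · simp
  simp only [e]
  rw [integral_const_mul, integral_fintype_prod_eq_prod, ← Finset.mul_prod_erase _ _
    (Finset.mem_univ i), mul_left_comm]
  congr 1
  · simp [φ]
  · congr 1
    refine Finset.prod_congr rfl fun j hj => ?_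
    simp [φ, Finset.ne_of_mem_erase hj]

lemma integrable_prefixProb_mul (μ : Measure D.Policy) [IsFiniteMeasure μ] (i : Fin D.N) (n : ℕ)
    (ω : D.Traj) {ψ : D.LocalPolicy i → ℝ} (hψ : Measurable ψ) (h0 : ∀ p, 0 ≤ ψ p)
    (h1 : ∀ p, ψ p ≤ 1) : Integrable (fun π : D.Policy => prefixProb n π ω * ψ (π i)) μ := by
  have hm : Measurable fun π : D.Policy => ∏ j, polWeight j n (π j) ω :=
    Finset.measurable_fun_prod _ fun j _ =>
      (measurable_polWeight j _ ω).comp (measurable_pi_apply j)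
  refine Integrable.of_bound ((hm.const_mul _).mul
    (hψ.comp (measurable_pi_apply i))).aestronglyMeasurable (envWeight n ω)
    (Filter.Eventually.of_forall fun π => ?_)
  have hp0 : 0 ≤ ∏ j, polWeight j n (π j) ω := Finset.prod_nonneg fun _ _ => polWeight_nonneg _ _ _ _
  have hp1 : ∏ j, polWeight j n (π j) ω ≤ 1 :=
    Finset.prod_le_one (fun _ _ => polWeight_nonneg _ _ _ _) fun _ _ => polWeight_le_one _ _ _ _
  have he := envWeight_nonneg n ω
  simp only [prefixProb]
  rw [Real.norm_of_nonneg (mul_nonneg (mul_nonneg he hp0) (h0 _))]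
  exact (mul_le_of_le_one_right (mul_nonneg he hp0) (h1 _)).trans (mul_le_of_le_one_right he hp1)

/-- The weight that the environment and the agents other than `i` give to the history which agent
`i` has at time `n` of `ω`. -/
def othersWeight (ν : ∀ j, ProbabilityMeasure (D.LocalPolicy j)) (i : Fin D.N)
    (n : Fin (D.T + 1)) (ω : D.Traj) : ℝ :=
  ∑ ω', (evAO i n (aoHist ω i n)).indicator (fun ω' => envWeight n ω' *
    ∏ j ∈ Finset.univ.erase i, ∫ p, polWeight j n p ω' ∂(ν j : Measure (D.LocalPolicy j))) ω'

lemma integral_sum_indicator_prefixProb_mul (ν : ∀ j, ProbabilityMeasure (D.LocalPolicy j))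
    (i : Fin D.N) (n : Fin (D.T + 1)) (ω : D.Traj) {ψ : D.LocalPolicy i → ℝ} (hψ : Measurable ψ)
    (h0 : ∀ p, 0 ≤ ψ p) (h1 : ∀ p, ψ p ≤ 1) :
    ∫ π, ∑ ω', (evAO i n (aoHist ω i n)).indicator (fun ω' => prefixProb n π ω' * ψ (π i)) ω'
        ∂(Measure.pi fun j => (ν j : Measure (D.LocalPolicy j))) =
      (∫ p, polWeight i n p ω * ψ p ∂(ν i : Measure (D.LocalPolicy i))) *
        othersWeight ν i n ω := by
  classical
  rw [integral_finsetSum, othersWeight, Finset.mul_sum]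
  · refine Finset.sum_congr rfl fun ω' _ => ?_
    by_cases h : ω' ∈ evAO i n (aoHist ω i n)
    · simp only [Set.indicator_of_mem h, integral_prefixProb_mul]
      -- On the event, agent `i`'s factor is the same for all episodes, so it leaves the sum.
      simp only [polWeight_eq_of_aoHist_eq (show aoHist ω' i n = aoHist ω i n from h)]
    · simp [h]
  · intro ω' _
    by_cases h : ω' ∈ evAO i n (aoHist ω i n)
    · simp only [Set.indicator_of_mem h]
      exact integrable_prefixProb_mul _ i n ω' hψ h0 h1
    · simp [h]

/-- Under a product distribution, the probability of a history of agent `i`, and of the next action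
jointly with it, factor into a contribution of agent `i` and one of everything else. -/
lemma exists_mixProb_eq_mul_othersWeight (i : Fin D.N) (n : Fin (D.T + 1)) : ∃ c : ℝ, 0 < c ∧
    ∀ (ν : ∀ j, ProbabilityMeasure (D.LocalPolicy j)) (ω : D.Traj),
      mixProb (Measure.pi fun j => (ν j : Measure (D.LocalPolicy j))) (evAO i n (aoHist ω i n)) =
        (∫ p, polWeight i n p ω ∂(ν i : Measure (D.LocalPolicy i))) *
          (c * othersWeight ν i n ω) ∧
      mixProb (Measure.pi fun j => (ν j : Measure (D.LocalPolicy j)))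
          (evAct i n (ω.2.1 n i) ∩ evAO i n (aoHist ω i n)) =
        (∫ p, polWeight i (n + 1) p ω ∂(ν i : Measure (D.LocalPolicy i))) *
          (c * othersWeight ν i n ω) := by
  obtain ⟨c, hc, hsum⟩ := exists_sum_trajProb_indicator i n
  refine ⟨c, hc, fun ν ω => ⟨?_, ?_⟩⟩
  · rw [mixProb_eq_integral]
    simp only [(hsum _ _).1]
    rw [integral_const_mul]
    have h := integral_sum_indicator_prefixProb_mul ν i n ω (ψ := fun _ => 1) measurable_const
      (fun _ => zero_le_one) fun _ => le_rfl
    simp only [mul_one] at h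
    rw [h, mul_left_comm]
  · rw [mixProb_eq_integral]
    simp only [(hsum _ _).2]
    rw [integral_const_mul, integral_sum_indicator_prefixProb_mul ν i n ω
      (ψ := fun p => p n (aoHist ω i n) (ω.2.1 n i)) (measurable_localPolicy_apply _ _ _)
      (fun p => (p _ _).2.1 _) fun p => (mem_Icc_of_mem_stdSimplex (p _ _).2 _).2, mul_left_comm]
    simp only [polWeight_succ, polStep_fin]

/-! ### Local policies that represent a distribution -/

lemma polWeight_uniform_pos (i : Fin D.N) [Nonempty (D.Act i)] (n : ℕ) (ω : D.Traj) :
    0 < polWeight i n (fun _ _ => uniformSimplex (D.Act i)) ω := by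
  refine Finset.prod_pos fun t _ => ?_
  unfold polStep
  split_ifs
  · exact one_div_pos.2 (Nat.cast_pos.2 Fintype.card_pos)
  · exact one_pos

/-- Along an episode that the environment can produce, a history that agent `i` reaches with
positive probability is reached against some distribution of the other agents. -/
lemma exists_mixProb_evAO_pos (i : Fin D.N) (μi : ProbabilityMeasure (D.LocalPolicy i))
    (n : Fin (D.T + 1)) (ω : D.Traj) (henv : 0 < envWeight n ω)
    (hpos : 0 < ∫ p, polWeight i n p ω ∂(μi : Measure (D.LocalPolicy i))) :
    ∃ ν : ∀ j, ProbabilityMeasure (D.LocalPolicy j), ν i = μi ∧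
      0 < mixProb (Measure.pi fun j => (ν j : Measure (D.LocalPolicy j)))
        (evAO i n (aoHist ω i n)) := by
  classical
  have hne : ∀ j, Nonempty (D.Act j) := fun j => ⟨ω.2.1 0 j⟩
  -- Uniformly random opponents exclude no action, so the term of `ω` itself is positive.
  let ν₀ : ∀ j, ProbabilityMeasure (D.LocalPolicy j) := fun j =>
    ⟨Measure.dirac fun _ _ => uniformSimplex (D.Act j), inferInstance⟩
  refine ⟨Function.update ν₀ i μi, Function.update_self .., ?_⟩
  obtain ⟨c, hc, h⟩ := exists_mixProb_eq_mul_othersWeight i n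
  rw [(h _ ω).1, Function.update_self]
  refine mul_pos hpos (mul_pos hc ?_)
  refine Finset.sum_pos' (fun ω' _ => Set.indicator_nonneg (fun ω' _ => mul_nonneg
    (envWeight_nonneg _ _) (Finset.prod_nonneg fun j _ => integral_polWeight_nonneg _ _ _)) _)
    ⟨ω, Finset.mem_univ _, ?_⟩
  rw [Set.indicator_of_mem (show ω ∈ evAO i n (aoHist ω i n) from rfl)]
  refine mul_pos henv (Finset.prod_pos fun j hj => ?_)
  rw [Function.update_of_ne (Finset.ne_of_mem_erase hj)]
  change 0 < ∫ p, polWeight j n p ω ∂(Measure.dirac fun _ _ => uniformSimplex (D.Act j))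
  rw [integral_dirac' _ _ (measurable_polWeight j n ω).stronglyMeasurable]
  exact polWeight_uniform_pos j n ω

lemma envWeight_pos_of_le {m n : ℕ} (hmn : m ≤ n) {ω : D.Traj} (h : 0 < envWeight n ω) :
    0 < envWeight m ω := by
  induction hmn with
  | refl => exact h
  | step _ ih =>
    rw [envWeight_succ] at h
    exact ih (pos_of_mul_pos_left h (envStep_nonneg _ _))

/-- Along every episode that the environment can produce, the local policy corresponding to a
distribution gives the actions of agent `i` the weight that the distribution gives them. -/
lemma polWeight_localOfDist (i : Fin D.N) (μi : ProbabilityMeasure (D.LocalPolicy i))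
    {n : ℕ} (hn : n ≤ D.T + 1) (ω : D.Traj) (henv : 0 < envWeight (D.T + 1) ω) :
    polWeight i n (localOfDist i μi) ω =
      ∫ p, polWeight i n p ω ∂(μi : Measure (D.LocalPolicy i)) := by
  induction n with
  | zero => simp [polWeight]
  | succ n ih =>
    rw [polWeight_succ, ih (by omega)]
    -- If the history has mean weight zero, so does its extension, and the value of `localOfDist`
    -- there is irrelevant.
    rcases (integral_polWeight_nonneg (μi : Measure (D.LocalPolicy i)) n ω).eq_or_lt with h0 | hpos
    · rw [← h0, zero_mul]
      refine le_antisymm (integral_polWeight_nonneg _ _ _) ?_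
      rw [h0]
      refine integral_mono (integrable_polWeight _ _ _) (integrable_polWeight _ _ _) fun p => ?_
      simp only [polWeight_succ]
      exact mul_le_of_le_one_right (polWeight_nonneg _ _ _ _) (polStep_le_one _ _ _ _)
    · let t : Fin (D.T + 1) := ⟨n, hn⟩
      have hex := exists_mixProb_evAO_pos i μi t ω
        (envWeight_pos_of_le (Nat.le_of_succ_le hn) henv) hpos
      obtain ⟨c, hc, h⟩ := exists_mixProb_eq_mul_othersWeight i t
      obtain ⟨h1, h2⟩ := h hex.choose ω
      have hpos' := hex.choose_spec.2
      -- Only the chosen family enters the definition; the factor `c * othersWeight` depending on it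
      -- cancels, leaving the ratio of consecutive mean weights.
      have e : polStep i n (localOfDist i μi) ω =
          mixProb (Measure.pi fun j => (hex.choose j : Measure (D.LocalPolicy j)))
              (evAct i t (ω.2.1 t i) ∩ evAO i t (aoHist ω i t)) /
            mixProb (Measure.pi fun j => (hex.choose j : Measure (D.LocalPolicy j)))
              (evAO i t (aoHist ω i t)) := by
        rw [show n = (t : ℕ) from rfl, polStep_fin, localOfDist, dif_pos hex]
        rfl
      rw [h1] at hpos'
      rw [e, h1, h2]
      rw [hex.choose_spec.1] at hpos' ⊢
      have hC := (pos_iff_pos_of_mul_pos hpos').1 hpos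
      rw [mul_div_mul_right _ _ hC.ne']
      exact mul_div_cancel₀ _ hpos.ne'

/-- The return of the local policies corresponding to distributions. -/
lemma J_localOfDist (μ : ∀ i, ProbabilityMeasure (D.LocalPolicy i)) :
    J (fun i => localOfDist i (μ i)) =
      ∑ ω : D.Traj, (envWeight (D.T + 1) ω *
        ∏ i, ∫ p, polWeight i (D.T + 1) p ω ∂(μ i : Measure (D.LocalPolicy i))) *
          ∑ t : Fin (D.T + 1), D.reward (ω.1 t) (ω.2.1 t) := by
  refine Finset.sum_congr rfl fun ω _ => ?_
  rw [trajProb_eq_prefixProb, prefixProb]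
  -- Where the environment gives weight zero the policies need not match, but the term vanishes on
  -- both sides.
  rcases (envWeight_nonneg (D.T + 1) ω).eq_or_lt with h0 | hpos
  · simp [← h0]
  · simp only [polWeight_localOfDist _ _ le_rfl ω hpos]

/-! ### The symmetrizer -/

/-- Independence: a product of averages is the average over independent draws. -/
lemma prod_expect {ι : Type v} {X : Type w} [Fintype ι] [DecidableEq ι] [Fintype X]
    (F : ι → X → ℝ) : ∏ i, 𝔼 x, F i x = 𝔼 φ : ι → X, ∏ i, F i (φ i) := by
  simp only [Fintype.expect_eq_sum_div_card, Finset.prod_div_distrib, Fintype.prod_sum,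
    Finset.prod_const, Finset.card_univ, Fintype.card_fun, Nat.cast_pow]

lemma expect_eval {ι : Type v} {X : Type w} [Fintype ι] [DecidableEq ι] [Fintype X] [Nonempty X]
    (i : ι) (F : X → ℝ) : 𝔼 φ : ι → X, F (φ i) = 𝔼 x, F x := by
  -- The product has `F` as its factor at `i` and `1` elsewhere.
  have h := prod_expect fun j x => if j = i then F x else 1
  have e : ∀ j, 𝔼 x, (if j = i then F x else 1) = if j = i then 𝔼 x, F x else 1 := fun j => by
    split_ifs
    · rfl
    · exact Fintype.expect_const _
  simpa [e] using h.symm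

lemma integral_opDist (π : D.Policy) {F : D.Policy → ℝ} (hF : Measurable F) :
    ∫ p, F p ∂(opDist π : Measure D.Policy) = 𝔼 φ : Fin D.N → Aut D, F (profilePush φ π) := by
  change ∫ p, F p ∂(((Fintype.card (Aut D) : ℝ≥0∞) ^ D.N)⁻¹ •
      ∑ φ : Fin D.N → Aut D, Measure.dirac (profilePush φ π)) = _
  rw [integral_smul_measure, integral_finsetSum_measure]
  · simp only [integral_dirac' F _ hF.stronglyMeasurable]
    rw [Fintype.expect_eq_sum_div_card, div_eq_inv_mul]
    simp
  · intro φ _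
    exact integrable_dirac' hF.stronglyMeasurable (by simp)

/-- The return of the symmetrizations is the average return over profiles of automorphisms. -/
lemma J_symmetrizer (π : Fin D.N → D.Policy) :
    J (fun k => symmetrizer (π k) k) =
      𝔼 φ : Fin D.N → Aut D, J (fun k => (φ k).push (π k) k) := by
  have hint : ∀ (ω : D.Traj) (i : Fin D.N),
      ∫ p, polWeight i (D.T + 1) p ω
        ∂((opDist (π i)).map (measurable_pi_apply i).aemeasurable : Measure (D.LocalPolicy i)) =
      𝔼 g : Aut D, polWeight i (D.T + 1) (g.push (π i) i) ω := fun ω i => by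
    rw [ProbabilityMeasure.toMeasure_map, integral_map (measurable_pi_apply i).aemeasurable
      (measurable_polWeight i _ ω).aestronglyMeasurable]
    refine (integral_opDist _ ((measurable_polWeight i _ ω).comp (measurable_pi_apply i))).trans ?_
    exact expect_eval i fun g : Aut D => polWeight i (D.T + 1) (g.push (π i) i) ω
  simp only [symmetrizer]
  rw [J_localOfDist]
  simp only [hint, prod_expect, Finset.mul_expect, Finset.expect_mul]
  rw [← Finset.expect_sum_comm]
  refine Finset.expect_congr rfl fun φ _ => ?_
  simp only [J, trajProb_eq_prefixProb, prefixProb]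

/-! ### Composition of isomorphisms -/

lemma piCongr_eq_iff {α : Type*} {β : Type*} {W : α → Type v} {Z : β → Type w} (e : α ≃ β)
    (g : ∀ i, W i ≃ Z (e i)) (x : ∀ i, W i) (y : ∀ j, Z j) :
    Equiv.piCongr e g x = y ↔ ∀ i, g i (x i) = y (e i) := by
  refine ⟨fun h i => ?_, fun h => ?_⟩
  · rw [← h, Equiv.piCongr_apply_apply]
  · funext j
    obtain ⟨i, rfl⟩ := e.surjective j
    rw [Equiv.piCongr_apply_apply, h]

/-- The bijections over `e.symm` which invert the bijections `g` over `e`. -/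
def symmFamily {α : Type*} {β : Type*} {W : α → Type v} {Z : β → Type w} (e : α ≃ β)
    (g : ∀ i, W i ≃ Z (e i)) (j : β) : Z j ≃ W (e.symm j) :=
  (Equiv.cast (congrArg Z (e.apply_symm_apply j).symm)).trans (g (e.symm j)).symm

/-- Since `e.symm (e i) = i` is not definitional, the inverse law is stated in the sigma type, where
no cast appears. -/
lemma symmFamily_sigma {α : Type*} {β : Type*} {W : α → Type v} {Z : β → Type w} (e : α ≃ β)
    (g : ∀ i, W i ≃ Z (e i)) (i : α) (x : W i) :
    (⟨e.symm (e i), symmFamily e g (e i) (g i x)⟩ : Σ i, W i) = ⟨i, x⟩ := by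
  -- Generalizing `e.symm (e i)` to a variable `i'` allows the index equation to be eliminated.
  have key : ∀ (i' : α) (h : i' = i) (hZ : Z (e i) = Z (e i')),
      (⟨i', (g i').symm (cast hZ (g i x))⟩ : Σ i, W i) = ⟨i, x⟩ := by
    rintro _ rfl hZ
    simp
  exact key _ (e.symm_apply_apply i) _

lemma piCongr_symmFamily {α : Type*} {β : Type*} {W : α → Type v} {Z : β → Type w} (e : α ≃ β)
    (g : ∀ i, W i ≃ Z (e i)) (x : ∀ i, W i) :
    Equiv.piCongr e.symm (symmFamily e g) (Equiv.piCongr e g x) = x := by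
  rw [piCongr_eq_iff]
  intro j
  obtain ⟨i, rfl⟩ := e.surjective j
  rw [Equiv.piCongr_apply_apply]
  have h := symmFamily_sigma e g i (x i)
  have h' : (⟨e.symm (e i), x (e.symm (e i))⟩ : Σ i, W i) = ⟨i, x i⟩ := by
    rw [e.symm_apply_apply]
  exact eq_of_heq (Sigma.mk.inj (h.trans h'.symm)).2

lemma piCongr_trans {α : Type*} {β : Type*} {γ : Type*} {W : α → Type u} {Z : β → Type v}
    {V : γ → Type w} (e : α ≃ β) (g : ∀ i, W i ≃ Z (e i)) (e' : β ≃ γ) (g' : ∀ j, Z j ≃ V (e' j))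
    (x : ∀ i, W i) :
    Equiv.piCongr (Z := V) (e.trans e') (fun i => (g i).trans (g' (e i))) x =
      Equiv.piCongr e' g' (Equiv.piCongr e g x) := by
  rw [piCongr_eq_iff]
  intro i
  simp only [Equiv.trans_apply, Equiv.piCongr_apply_apply]
  rfl

lemma family_eq_of_sigma_eq {α : Type*} {β : Type*} {W : α → Type v} {Z : β → Type w} {e : α → β}
    {g g' : ∀ i, W i ≃ Z (e i)}
    (h : ∀ i x, (⟨e i, g i x⟩ : Σ j, Z j) = ⟨e i, g' i x⟩) : g = g' := by
  funext i
  ext x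
  exact eq_of_heq (Sigma.mk.inj (h i x)).2

/-! ### Isomorphisms as a groupoid acting on policies -/

namespace Iso

variable {E : DecPOMDP.{v}} {G : DecPOMDP.{w}}

lemma ext_sigma {f g : Iso D E} (hN : ∀ i, f.fN i = g.fN i) (hS : ∀ s, f.fS s = g.fS s)
    (hA : ∀ i a, (⟨f.fN i, f.fA i a⟩ : Σ j, E.Act j) = ⟨g.fN i, g.fA i a⟩)
    (hO : ∀ i o, (⟨f.fN i, f.fO i o⟩ : Σ j, E.Obs j) = ⟨g.fN i, g.fO i o⟩) : f = g := by
  obtain ⟨a, b, c, d, _⟩ := f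
  obtain ⟨a', b', c', d', _⟩ := g
  obtain rfl : a = a' := Equiv.ext hN
  obtain rfl : b = b' := Equiv.ext hS
  obtain rfl : c = c' := family_eq_of_sigma_eq hA
  obtain rfl : d = d' := family_eq_of_sigma_eq hO
  rfl

/-- Composition of isomorphisms. -/
def trans (f : Iso D E) (g : Iso E G) : Iso D G where
  fN := f.fN.trans g.fN
  fS := f.fS.trans g.fS
  fA i := (f.fA i).trans (g.fA (f.fN i))
  fO i := (f.fO i).trans (g.fO (f.fN i))
  horizon_eq := f.horizon_eq.trans g.horizon_eq
  trans_eq s a s' := by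
    rw [piCongr_trans, f.trans_eq, g.trans_eq]
    rfl
  obs_eq s a o := by
    rw [piCongr_trans, piCongr_trans, f.obs_eq, g.obs_eq]
    rfl
  reward_eq s a := by
    rw [piCongr_trans, f.reward_eq, g.reward_eq]
    rfl
  init_eq s := by
    rw [f.init_eq, g.init_eq]
    rfl

/-- The inverse isomorphism. -/
def symm (f : Iso D E) : Iso E D where
  fN := f.fN.symm
  fS := f.fS.symm
  fA := symmFamily f.fN f.fA
  fO := symmFamily f.fN f.fO
  horizon_eq := f.horizon_eq.symm
  trans_eq s a s' := by
    obtain ⟨s, rfl⟩ := f.fS.surjective s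
    obtain ⟨s', rfl⟩ := f.fS.surjective s'
    obtain ⟨a, rfl⟩ := (Equiv.piCongr f.fN f.fA).surjective a
    rw [piCongr_symmFamily, f.fS.symm_apply_apply, f.fS.symm_apply_apply, f.trans_eq]
  obs_eq s a o := by
    obtain ⟨s, rfl⟩ := f.fS.surjective s
    obtain ⟨a, rfl⟩ := (Equiv.piCongr f.fN f.fA).surjective a
    obtain ⟨o, rfl⟩ := (Equiv.piCongr f.fN f.fO).surjective o
    rw [piCongr_symmFamily, piCongr_symmFamily, f.fS.symm_apply_apply, f.obs_eq]
  reward_eq s a := by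
    obtain ⟨s, rfl⟩ := f.fS.surjective s
    obtain ⟨a, rfl⟩ := (Equiv.piCongr f.fN f.fA).surjective a
    rw [piCongr_symmFamily, f.fS.symm_apply_apply, f.reward_eq]
  init_eq s := by
    obtain ⟨s, rfl⟩ := f.fS.surjective s
    rw [f.fS.symm_apply_apply, f.init_eq]

lemma trans_symm_trans (f : Iso D E) (g : Iso D G) : f.trans (f.symm.trans g) = g := by
  refine ext_sigma (fun i => ?_) (fun s => ?_) (fun i a => ?_) fun i o => ?_
  · exact congrArg g.fN (f.fN.symm_apply_apply i)
  · exact congrArg g.fS (f.fS.symm_apply_apply s)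
  · exact congrArg (fun z : Σ i, D.Act i => (⟨g.fN z.1, g.fA z.1 z.2⟩ : Σ j, G.Act j))
      (symmFamily_sigma f.fN f.fA i a)
  · exact congrArg (fun z : Σ i, D.Obs i => (⟨g.fN z.1, g.fO z.1 z.2⟩ : Σ j, G.Obs j))
      (symmFamily_sigma f.fN f.fO i o)

lemma trans_injective (f : Iso D E) :
    Function.Injective (f.trans : Iso E G → Iso D G) := by
  intro g g' h
  have hN : ∀ i, g.fN (f.fN i) = g'.fN (f.fN i) := fun i =>
    congrArg (fun k : Iso D G => k.fN i) h
  have hS : ∀ s, g.fS (f.fS s) = g'.fS (f.fS s) := fun s =>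
    congrArg (fun k : Iso D G => k.fS s) h
  have hA : ∀ i a, (⟨g.fN (f.fN i), g.fA _ (f.fA i a)⟩ : Σ j, G.Act j) =
      ⟨g'.fN (f.fN i), g'.fA _ (f.fA i a)⟩ := fun i a =>
    congrArg (fun k : Iso D G => (⟨k.fN i, k.fA i a⟩ : Σ j, G.Act j)) h
  have hO : ∀ i o, (⟨g.fN (f.fN i), g.fO _ (f.fO i o)⟩ : Σ j, G.Obs j) =
      ⟨g'.fN (f.fN i), g'.fO _ (f.fO i o)⟩ := fun i o =>
    congrArg (fun k : Iso D G => (⟨k.fN i, k.fO i o⟩ : Σ j, G.Obs j)) h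
  refine ext_sigma (fun j => ?_) (fun s => ?_) (fun j a => ?_) fun j o => ?_
  · obtain ⟨i, rfl⟩ := f.fN.surjective j
    exact hN i
  · obtain ⟨s, rfl⟩ := f.fS.surjective s
    exact hS s
  · obtain ⟨i, rfl⟩ := f.fN.surjective j
    obtain ⟨a, rfl⟩ := (f.fA i).surjective a
    exact hA i a
  · obtain ⟨i, rfl⟩ := f.fN.surjective j
    obtain ⟨o, rfl⟩ := (f.fO i).surjective o
    exact hO i o

/-- Composition with an isomorphism `f : D → E` is a bijection between the isomorphisms starting at
`E` and those starting at `D`. -/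
def transEquiv (f : Iso D E) : Iso E G ≃ Iso D G :=
  Equiv.ofBijective f.trans ⟨f.trans_injective, fun g => ⟨f.symm.trans g, f.trans_symm_trans g⟩⟩

/-- Functoriality of the pushforward. Every agent of `G` is some `g.fN (f.fN i)`, and there both
sides relabel the policy of `i` by the same maps. -/
lemma push_trans (f : Iso D E) (g : Iso E G) (π : D.Policy) :
    (f.trans g).push π = g.push (f.push π) := by
  funext k
  obtain ⟨j, rfl⟩ := g.fN.surjective k
  obtain ⟨i, rfl⟩ := f.fN.surjective j
  rw [push_apply, push_apply]
  exact push_apply (f.trans g) π i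

lemma coe_pushDist (f : Iso D E) (ν : ProbabilityMeasure D.Policy) :
    (f.pushDist ν : Measure E.Policy) = (ν : Measure D.Policy).map f.push :=
  rfl

lemma coe_pushDist_trans (f : Iso D E) (g : Iso E G) (ν : ProbabilityMeasure D.Policy) :
    ((f.trans g).pushDist ν : Measure G.Policy) = (f.pushDist ν : Measure E.Policy).map g.push := by
  rw [coe_pushDist, coe_pushDist, Measure.map_map g.measurable_push f.measurable_push]
  congr 1
  funext π
  exact push_trans f g π

end Iso

/-! ### The payoff of the label-free coordination game -/

instance : Nonempty D.relabeled :=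
  ⟨⟨_, Classical.arbitrary (Labeling D), rfl⟩⟩

lemma measurable_push_diagonal (φ : Fin D.N → Aut D) :
    Measurable fun (π : Fin D.N → D.Policy) (k : Fin D.N) => (φ k).push (π k) k :=
  measurable_pi_lambda _ fun k =>
    (measurable_pi_apply k).comp ((φ k).measurable_push.comp (measurable_pi_apply k))

lemma integral_expect {ι : Type w} [Fintype ι] {Ω : Type v} [MeasurableSpace Ω] {μ : Measure Ω}
    {F : ι → Ω → ℝ} (hF : ∀ i, Integrable (F i) μ) :
    ∫ x, 𝔼 i, F i x ∂μ = 𝔼 i, ∫ x, F i x ∂μ := by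
  simp only [Fintype.expect_eq_sum_div_card]
  rw [integral_div, integral_finsetSum _ fun i _ => hF i]

/-- The symmetrizer is defined by a choice and is not visibly measurable, but `J_symmetrizer` turns
the return into a finite average of measurable functions. -/
lemma measurable_J_symmetrizer :
    Measurable fun π : Fin D.N → D.Policy => J (fun k => symmetrizer (π k) k) := by
  simp only [J_symmetrizer, Fintype.expect_eq_sum_div_card]
  exact (Finset.measurable_fun_sum _ fun φ _ =>
    measurable_J.comp (measurable_push_diagonal φ)).div_const _

/-- For fixed labelings, averaging over the isomorphisms to `D` amounts to symmetrizing the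
policies that were transported along an arbitrary choice of isomorphisms. -/
lemma expect_iso_integral_J {E : Fin D.N → DecPOMDP.{v}} (f : ∀ j, Iso (E j) D)
    (ν : ∀ j, ProbabilityMeasure (E j).Policy) :
    𝔼 g : (∀ j, Iso (E j) D), ∫ π : Fin D.N → D.Policy, J (fun l => π l l)
        ∂(Measure.pi fun k => ((g k).pushDist (ν k) : Measure D.Policy)) =
      ∫ π : Fin D.N → D.Policy, J (fun k => symmetrizer (π k) k)
        ∂(Measure.pi fun j => ((f j).pushDist (ν j) : Measure D.Policy)) := by
  simp only [J_symmetrizer]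
  rw [integral_expect fun φ => integrable_J_comp _ (measurable_push_diagonal φ)]
  symm
  -- Every profile of isomorphisms is uniquely `(f j).trans (φ j)` for a profile `φ` of
  -- automorphisms.
  refine Fintype.expect_equiv (Equiv.piCongrRight fun j => (f j).transEquiv) _ _ fun φ => ?_
  have hmeas : ∀ k, AEMeasurable (φ k).push ((f k).pushDist (ν k) : Measure D.Policy) :=
    fun k => (φ k).measurable_push.aemeasurable
  have hsf : ∀ k, SigmaFinite (((f k).pushDist (ν k) : Measure D.Policy).map (φ k).push) :=
    fun k => by
      have := Measure.isProbabilityMeasure_map (hmeas k)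
      infer_instance
  have e : (Measure.pi fun k => (((Equiv.piCongrRight fun j => (f j).transEquiv) φ k).pushDist
      (ν k) : Measure D.Policy)) =
      (Measure.pi fun k => ((f k).pushDist (ν k) : Measure D.Policy)).map
        fun π k => (φ k).push (π k) := by
    rw [Measure.pi_map_pi hmeas]
    congr 1
    funext k
    exact Iso.coe_pushDist_trans (f k) (φ k) (ν k)
  rw [e, integral_map]
  · exact (measurable_pi_lambda _ fun k =>
      (φ k).measurable_push.comp (measurable_pi_apply k)).aemeasurable
  · exact (measurable_J.comp (measurable_pi_lambda _ fun k =>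
      (measurable_pi_apply k).comp (measurable_pi_apply k))).aestronglyMeasurable

/-- If the transported policies are almost surely equivalent to fixed policies, the return of the
symmetrizations is constant. -/
lemma integral_J_symmetrizer_of_equivalent {E : Fin D.N → DecPOMDP.{v}} (f : ∀ j, Iso (E j) D)
    (ν : ∀ j, ProbabilityMeasure (E j).Policy) (ρ : Fin D.N → D.Policy)
    (h : ∀ k, ∀ᵐ p ∂(ν k : Measure (E k).Policy), Equivalent ((f k).push p) (ρ k)) :
    ∫ π : Fin D.N → D.Policy, J (fun k => symmetrizer (π k) k)
        ∂(Measure.pi fun j => ((f j).pushDist (ν j) : Measure D.Policy)) =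
      J (fun k => symmetrizer (ρ k) k) := by
  have hmeas : ∀ k, AEMeasurable (f k).push (ν k : Measure (E k).Policy) :=
    fun k => (f k).measurable_push.aemeasurable
  have hsf : ∀ k, SigmaFinite ((ν k : Measure (E k).Policy).map (f k).push) :=
    fun k => by
      have := Measure.isProbabilityMeasure_map (hmeas k)
      infer_instance
  have hpush : Measurable fun (π : ∀ k, (E k).Policy) k => (f k).push (π k) :=
    measurable_pi_lambda _ fun k => (f k).measurable_push.comp (measurable_pi_apply k)
  simp only [Iso.coe_pushDist]
  rw [← Measure.pi_map_pi hmeas, integral_map hpush.aemeasurable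
    measurable_J_symmetrizer.aestronglyMeasurable]
  have hae : ∀ᵐ π ∂(Measure.pi fun k => (ν k : Measure (E k).Policy)),
      J (fun k => symmetrizer ((f k).push (π k)) k) = J (fun k => symmetrizer (ρ k) k) := by
    -- Each hypothesis concerns one coordinate; null sets of a marginal pull back to null sets of
    -- the product, and there are finitely many agents.
    have hall := ae_all_iff.2 fun k => (Measure.quasiMeasurePreserving_eval
      (fun k => (ν k : Measure (E k).Policy)) k).ae (h k)
    filter_upwards [hall] with π hπ
    congr 1
    funext k
    exact congrFun (hπ k) k
  rw [integral_congr_ae hae]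
  simp

end

end DecPOMDP

theorem mainTheorem6 (D : DecPOMDP.{u})
    (σ : Fin D.N → DecPOMDP.LearningAlg D.relabeled)
    (f : ∀ E : D.relabeled, DecPOMDP.Iso E.1 D) :
    D.payoff σ =
        𝔼 d : Fin D.N → D.relabeled,
          ∫ π : Fin D.N → D.Policy, DecPOMDP.J (fun k => DecPOMDP.symmetrizer (π k) k)
            ∂(Measure.pi fun j => ((f (d j)).pushDist (σ j (d j)) : Measure D.Policy)) ∧
      ∀ ρ : Fin D.N → D.Policy,
        (∀ k, ∀ E : D.relabeled, ∀ᵐ p ∂(σ k E : Measure E.1.Policy),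
          DecPOMDP.Equivalent ((f E).push p) (ρ k)) →
        D.payoff σ = DecPOMDP.J (fun k => DecPOMDP.symmetrizer (ρ k) k) := by
  have hpay : D.payoff σ = 𝔼 d : Fin D.N → D.relabeled,
      ∫ π : Fin D.N → D.Policy, DecPOMDP.J (fun k => DecPOMDP.symmetrizer (π k) k)
        ∂(Measure.pi fun j => ((f (d j)).pushDist (σ j (d j)) : Measure D.Policy)) :=
    Finset.expect_congr rfl fun d _ =>
      DecPOMDP.expect_iso_integral_J (fun j => f (d j)) fun j => σ j (d j)
  refine ⟨hpay, fun ρ hρ => ?_⟩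
  have hconst : ∀ d : Fin D.N → D.relabeled,
      ∫ π : Fin D.N → D.Policy, DecPOMDP.J (fun k => DecPOMDP.symmetrizer (π k) k)
        ∂(Measure.pi fun j => ((f (d j)).pushDist (σ j (d j)) : Measure D.Policy)) =
      DecPOMDP.J (fun k => DecPOMDP.symmetrizer (ρ k) k) := fun d =>
    DecPOMDP.integral_J_symmetrizer_of_equivalent (fun j => f (d j)) (fun j => σ j (d j)) ρ
      fun k => hρ k (d k)
  simp only [hpay, hconst]
  exact Fintype.expect_const _
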